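/- A topological dynamical system is a pair $(X,T)$ where $X$ is a nonempty compact metric space and $T:X\to X$ is a homeomorphism. A set $A$ is invariant if $TA=A$. The system is minimal if $X$ has no proper nonempty closed invariant subset. For $x\in X$ let $\overline{\mathcal O}(x,T)$ be the closure of the orbit $\{T^n x:n\in\mathbb Z\}$, regarded as a system under the restriction of $T$; the point $x$ is a minimal point if this system is minimal, and $(X,T)$ is semi-simple if every point of $X$ is a minimal point. A joining of two systems $(X,T)$ and $(Y,S)$ is a closed subset $J\subseteq X\times Y$ with $(T\times S)J=J$ that projects onto $X$ and onto $Y$; the systems are disjoint, written $(X,T)\perp(Y,S)$, if $X\times Y$ is their only joining. Theorem. Let $(X,T)$ be a semi-simple system. Then $(X,T)$ is disjoint from every minimal system if and only if the set $$\Delta_\perp(X)=\left\{(x_1,x_2)\in X\times X:\ (\overline{\mathcal O}(x_1,T),T)\perp(\overline{\mathcal O}(x_2,T),T)\right\}$$ is residual in $X\times X$ (that is, contains a countable intersection of dense open subsets of $X\times X$). -/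

import Mathlib

namespace TopDyn

universe u v

/-- A subset `A` of `X` is invariant under the homeomorphism `T` if `T A = A`. -/
def IsInvariantSet {X : Type u} [TopologicalSpace X] (T : X ≃ₜ X) (A : Set X) : Prop :=
  T '' A = A

/-- The system `(X, T)` is minimal: `X` is nonempty and has no proper nonempty closed
invariant subset. -/
def IsMinimalSystem {X : Type u} [TopologicalSpace X] (T : X ≃ₜ X) : Prop :=
  Nonempty X ∧ ∀ A : Set X, IsClosed A → IsInvariantSet T A → A.Nonempty → A = Set.univ

/-- The two-sided orbit `{T ^ n x : n ∈ ℤ}`. -/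
def orbit {X : Type u} [TopologicalSpace X] (T : X ≃ₜ X) (x : X) : Set X :=
  Set.range fun n : ℤ => (T ^ n) x

/-- The closure of the orbit of `x`. -/
def orbitClosure {X : Type u} [TopologicalSpace X] (T : X ≃ₜ X) (x : X) : Set X :=
  closure (orbit T x)

theorem image_orbit {X : Type u} [TopologicalSpace X] (T : X ≃ₜ X) (x : X) :
    T '' orbit T x = orbit T x := by
  ext y
  constructor
  · rintro ⟨_, ⟨n, rfl⟩, rfl⟩
    refine ⟨1 + n, ?_⟩
    simp only [zpow_add, zpow_one, Homeomorph.mul_apply]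
  · rintro ⟨n, rfl⟩
    refine ⟨(T ^ (n - 1)) x, ⟨n - 1, rfl⟩, ?_⟩
    rw [← Homeomorph.mul_apply, ← zpow_one_add, add_sub_cancel]

theorem isInvariant_orbitClosure {X : Type u} [TopologicalSpace X] (T : X ≃ₜ X) (x : X) :
    IsInvariantSet T (orbitClosure T x) := by
  unfold IsInvariantSet orbitClosure
  rw [T.image_closure, image_orbit]

/-- The restriction of `T` to an invariant subset `A`, as a homeomorphism of the subspace `A`. -/
def restrict {X : Type u} [TopologicalSpace X] (T : X ≃ₜ X) (A : Set X)
    (hA : IsInvariantSet T A) : A ≃ₜ A :=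
  T.subtype fun x =>
    (T.injective.mem_set_image (s := A) (a := x)).symm.trans (by rw [show T '' A = A from hA])

/-- The subsystem of `(X, T)` carried by the orbit closure of `x`. -/
def orbitSystem {X : Type u} [TopologicalSpace X] (T : X ≃ₜ X) (x : X) :
    orbitClosure T x ≃ₜ orbitClosure T x :=
  restrict T (orbitClosure T x) (isInvariant_orbitClosure T x)

/-- `x` is a minimal point of `(X, T)`: the subsystem on its orbit closure is minimal. -/
def IsMinimalPoint {X : Type u} [TopologicalSpace X] (T : X ≃ₜ X) (x : X) : Prop :=
  IsMinimalSystem (orbitSystem T x)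

/-- `(X, T)` is semi-simple: every point is a minimal point. -/
def IsSemisimple {X : Type u} [TopologicalSpace X] (T : X ≃ₜ X) : Prop :=
  ∀ x : X, IsMinimalPoint T x

/-- `J` is a joining of `(X, T)` and `(Y, S)`: a closed `T × S`-invariant subset of `X × Y`
that projects onto both coordinates. -/
structure IsJoining {X : Type u} {Y : Type v} [TopologicalSpace X] [TopologicalSpace Y]
    (T : X ≃ₜ X) (S : Y ≃ₜ Y) (J : Set (X × Y)) : Prop where
  isClosed : IsClosed J
  invariant : IsInvariantSet (T.prodCongr S) J
  image_fst : Prod.fst '' J = Set.univ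
  image_snd : Prod.snd '' J = Set.univ

/-- `(X, T)` and `(Y, S)` are disjoint: `X × Y` is their unique joining. -/
def AreDisjoint {X : Type u} {Y : Type v} [TopologicalSpace X] [TopologicalSpace Y]
    (T : X ≃ₜ X) (S : Y ≃ₜ Y) : Prop :=
  ∀ J : Set (X × Y), IsJoining T S J ↔ J = Set.univ

/-- `(X, T)` is disjoint from every minimal system `(Y, S)`, where `Y` is a compact metric
space and `S` a homeomorphism of `Y`. -/
def DisjointFromAllMinimal {X : Type u} [TopologicalSpace X] (T : X ≃ₜ X) : Prop :=
  ∀ (Y : Type u) [MetricSpace Y] [CompactSpace Y] (S : Y ≃ₜ Y),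
    IsMinimalSystem S → AreDisjoint T S

/-- The set of pairs whose orbit closures are disjoint as systems. -/
def disjointPairs {X : Type u} [TopologicalSpace X] (T : X ≃ₜ X) : Set (X × X) :=
  {p | AreDisjoint (orbitSystem T p.1) (orbitSystem T p.2)}

end TopDyn

namespace TopDyn

universe u v

open Set

/-! ### Invariance along orbits, and joinings. -/

section Basics

variable {X : Type u} [TopologicalSpace X] (T : X ≃ₜ X)

/-! If disjoint pairs are dense, let `J` be a joining of `X` with a minimal `Y`. Having a common
partner in `J` is a closed invariant relation, so it spreads from disjoint pairs to all pairs; by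
induction any finite piece of an orbit has a common partner (`IsJoining.exists_forall_zpow_mem`). By
compactness so does the whole orbit of `b`; its common partners form a closed invariant set, hence
all of `Y`, and `J` is everything.

Conversely, disjointness of two orbit closures follows from countably many conditions `hittingPairs
T U V`. Each has dense interior (`DisjointFromAllMinimal.dense_interior_hittingPairs`): disjointness
of `X` from the orbit closure of `x` gives one good `z`, and a Baire argument turns pointwise
goodness into an open box. -/

theorem isInvariantSet_iff {A : Set X} : IsInvariantSet T A ↔ ∀ x, T x ∈ A ↔ x ∈ A := by
  constructor
  · intro h x
    conv_lhs => rw [← (h : T '' A = A)]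
    exact T.injective.mem_set_image
  · intro h
    ext y
    constructor
    · rintro ⟨x, hx, rfl⟩
      exact (h x).2 hx
    · intro hy
      exact ⟨T.symm y, (h _).1 (by simpa using hy), by simp⟩

theorem apply_zpow_comm (n : ℤ) (x : X) : (T ^ n) (T x) = T ((T ^ n) x) := by
  have h : T ^ n * T = T * T ^ n := ((Commute.refl T).zpow_left n).eq
  exact DFunLike.congr_fun h x

theorem zpow_succ_apply (n : ℤ) (x : X) : (T ^ (n + 1)) x = (T ^ n) (T x) := by
  rw [zpow_add_one, Homeomorph.mul_apply]

theorem IsInvariantSet.zpow_mem_iff {T : X ≃ₜ X} {A : Set X} (h : IsInvariantSet T A) (n : ℤ)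
    (x : X) : (T ^ n) x ∈ A ↔ x ∈ A := by
  have h' := (isInvariantSet_iff T).1 h
  induction n using Int.induction_on generalizing x with
  | zero => simp
  | succ n ih => rw [zpow_succ_apply]; exact (ih _).trans (h' _)
  | pred n ih =>
    obtain ⟨z, rfl⟩ := T.surjective x
    rw [← zpow_succ_apply, sub_add_cancel]
    exact (ih z).trans (h' z).symm

theorem prod_zpow_mem_iff {A : Set (X × X)} (h : ∀ x z, (T x, T z) ∈ A ↔ (x, z) ∈ A) (n : ℤ)
    (x z : X) : ((T ^ n) x, (T ^ n) z) ∈ A ↔ (x, z) ∈ A := by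
  induction n using Int.induction_on generalizing x z with
  | zero => simp
  | succ n ih => simp only [zpow_succ_apply]; exact (ih _ _).trans (h _ _)
  | pred n ih =>
    obtain ⟨x, rfl⟩ := T.surjective x
    obtain ⟨z, rfl⟩ := T.surjective z
    simp only [← zpow_succ_apply, sub_add_cancel]
    exact (ih x z).trans (h x z).symm

theorem exists_zpow_apply_iff (p : X → Prop) (x : X) :
    (∃ n : ℤ, p ((T ^ n) (T x))) ↔ ∃ n : ℤ, p ((T ^ n) x) := by
  constructor
  · rintro ⟨n, hn⟩
    exact ⟨n + 1, by rwa [zpow_succ_apply]⟩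
  · rintro ⟨n, hn⟩
    exact ⟨n - 1, by rwa [← zpow_succ_apply, sub_add_cancel]⟩

theorem mem_orbitClosure_self (x : X) : x ∈ orbitClosure T x :=
  subset_closure ⟨0, by simp⟩

theorem apply_mem_orbitClosure_iff (x y : X) :
    T y ∈ orbitClosure T x ↔ y ∈ orbitClosure T x :=
  (isInvariantSet_iff T).1 (isInvariant_orbitClosure T x) y

@[simp] theorem coe_orbitSystem_apply (x : X) (y : orbitClosure T x) :
    ((orbitSystem T x y : orbitClosure T x) : X) = T y := rfl

theorem IsMinimalSystem.eq_univ {T : X ≃ₜ X} (h : IsMinimalSystem T) {A : Set X}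
    (hA : IsClosed A) (hT : ∀ x, T x ∈ A ↔ x ∈ A) (hne : A.Nonempty) : A = univ :=
  h.2 A hA ((isInvariantSet_iff T).2 hT) hne

variable {Y : Type v} [TopologicalSpace Y] (S : Y ≃ₜ Y)

theorem isJoining_univ [Nonempty X] [Nonempty Y] : IsJoining T S (univ : Set (X × Y)) where
  isClosed := isClosed_univ
  invariant := by simp [isInvariantSet_iff]
  image_fst := image_univ.trans Prod.fst_surjective.range_eq
  image_snd := image_univ.trans Prod.snd_surjective.range_eq

variable {T S}

theorem IsJoining.apply_mem_iff {J : Set (X × Y)} (h : IsJoining T S J) (x : X) (y : Y) :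
    (T x, S y) ∈ J ↔ (x, y) ∈ J :=
  (isInvariantSet_iff _).1 h.invariant (x, y)

theorem IsJoining.exists_left {J : Set (X × Y)} (h : IsJoining T S J) (y : Y) :
    ∃ x, (x, y) ∈ J := by
  obtain ⟨⟨x, y⟩, hp, rfl⟩ : y ∈ Prod.snd '' J := h.image_snd ▸ mem_univ y
  exact ⟨x, hp⟩

theorem IsJoining.exists_right {J : Set (X × Y)} (h : IsJoining T S J) (x : X) :
    ∃ y, (x, y) ∈ J := by
  obtain ⟨⟨x, y⟩, hp, rfl⟩ : x ∈ Prod.fst '' J := h.image_fst ▸ mem_univ x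
  exact ⟨y, hp⟩

/-- A nonempty closed invariant subset of a product of two compact minimal systems is a joining. -/
theorem IsMinimalSystem.isJoining [CompactSpace X] [CompactSpace Y] (hT : IsMinimalSystem T)
    (hS : IsMinimalSystem S) {J : Set (X × Y)} (hJ : IsClosed J)
    (hinv : ∀ x y, (T x, S y) ∈ J ↔ (x, y) ∈ J) (hne : J.Nonempty) : IsJoining T S J where
  isClosed := hJ
  invariant := (isInvariantSet_iff _).2 fun p => hinv p.1 p.2
  image_fst := by
    refine hT.eq_univ (isClosedMap_fst_of_compactSpace _ hJ) (fun x => ?_) (hne.image _)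
    simp only [mem_image, Prod.exists, exists_and_right, exists_eq_right]
    rw [S.surjective.exists (p := fun y => (T x, y) ∈ J)]
    simp [hinv]
  image_snd := by
    refine hS.eq_univ (isClosedMap_snd_of_compactSpace _ hJ) (fun y => ?_) (hne.image _)
    simp only [mem_image, Prod.exists, exists_eq_right]
    rw [T.surjective.exists (p := fun x => (x, S y) ∈ J)]
    simp [hinv]

end Basics

/-! ### Density of disjoint pairs implies disjointness from minimal systems. -/

section DensePairs

variable {X : Type u} [TopologicalSpace X] [CompactSpace X] {T : X ≃ₜ X}
  {Y : Type v} [TopologicalSpace Y] {S : Y ≃ₜ Y}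

/-- A joining with a minimal system remains onto over each orbit closure. -/
theorem IsJoining.exists_mem_orbitClosure (hS : IsMinimalSystem S) {J : Set (X × Y)}
    (hJ : IsJoining T S J) (x : X) (y : Y) : ∃ a ∈ orbitClosure T x, (a, y) ∈ J := by
  have hcl : IsClosed (Prod.snd '' (J ∩ orbitClosure T x ×ˢ univ)) :=
    isClosedMap_snd_of_compactSpace _ (hJ.isClosed.inter (isClosed_closure.prod isClosed_univ))
  have := hS.eq_univ hcl (fun y => ?_) ?_
  · obtain ⟨⟨a, y⟩, ⟨h1, h2⟩, rfl⟩ := this ▸ mem_univ y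
    exact ⟨a, h2.1, h1⟩
  · simp only [mem_image, Prod.exists, exists_eq_right]
    rw [T.surjective.exists]
    simp [hJ.apply_mem_iff, apply_mem_orbitClosure_iff]
  · obtain ⟨y, hy⟩ := hJ.exists_right x
    exact ⟨y, (x, y), ⟨hy, mem_orbitClosure_self T x, mem_univ _⟩, rfl⟩

variable [CompactSpace Y]

/-- If the pairs with disjoint orbit closures are dense, any finitely many points of an orbit have
a common partner in a joining with a minimal system. -/
theorem IsJoining.exists_forall_zpow_mem (hT : IsSemisimple T) (hd : Dense (disjointPairs T))
    (hS : IsMinimalSystem S) {J : Set (X × Y)} (hJ : IsJoining T S J) (F : Finset ℤ) (b : X) :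
    ∃ y, ∀ k ∈ F, ((T ^ k) b, y) ∈ J := by
  classical
  induction F using Finset.induction_on generalizing b with
  | empty => exact ⟨hS.1.some, by simp⟩
  | insert k₀ F _ ih =>
    let P : Set (X × X) := {p | ∃ y, (p.1, y) ∈ J ∧ ∀ k ∈ F, ((T ^ k) p.2, y) ∈ J}
    have hPcl : IsClosed P := by
      have h : IsClosed {q : (X × X) × Y |
          (q.1.1, q.2) ∈ J ∧ ∀ k ∈ F, ((T ^ k) q.1.2, q.2) ∈ J} := by
        simp only [ofPred_and, ofPred_forall]
        refine (hJ.isClosed.preimage (by fun_prop)).inter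
          (isClosed_iInter fun k => isClosed_iInter fun _ => ?_)
        exact hJ.isClosed.preimage (((T ^ k).continuous.comp (by fun_prop)).prodMk (by fun_prop))
      convert isClosedMap_fst_of_compactSpace _ h using 1
      ext p
      simp [P]
    have hPinv : ∀ a c, (T a, T c) ∈ P ↔ (a, c) ∈ P := by
      intro a c
      simp only [P, mem_ofPred_eq]
      rw [S.surjective.exists]
      simp [hJ.apply_mem_iff, apply_zpow_comm]
    have hsub : disjointPairs T ⊆ P := by
      rintro ⟨x₁, x₂⟩ hx
      have : CompactSpace (orbitClosure T x₁) :=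
        isCompact_iff_compactSpace.1 isClosed_closure.isCompact
      have : CompactSpace (orbitClosure T x₂) :=
        isCompact_iff_compactSpace.1 isClosed_closure.isCompact
      have key : IsJoining (orbitSystem T x₁) (orbitSystem T x₂)
          {p | ((p.1 : X), (p.2 : X)) ∈ P} := by
        refine IsMinimalSystem.isJoining (hT x₁) (hT x₂) (hPcl.preimage (by fun_prop))
          (fun a c => hPinv a c) ?_
        -- The common partner `y` of the orbit piece of `x₂` need not be a partner of `x₁`, but it
        -- is one of some point of its orbit closure; nonemptiness needs no more.
        obtain ⟨y, hy⟩ := ih x₂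
        obtain ⟨a, ha, hay⟩ := hJ.exists_mem_orbitClosure hS x₁ y
        exact ⟨(⟨a, ha⟩, ⟨x₂, mem_orbitClosure_self T x₂⟩), y, hay, hy⟩
      have huniv := (hx _).1 key
      exact (huniv ▸ mem_univ ((⟨x₁, mem_orbitClosure_self T x₁⟩,
        ⟨x₂, mem_orbitClosure_self T x₂⟩) : orbitClosure T x₁ × orbitClosure T x₂) :)
    have hP : P = univ := univ_subset_iff.1 (hd.closure_eq ▸ closure_minimal hsub hPcl)
    -- Both entries lie on one orbit, so this pair is reached only through density.
    obtain ⟨y, h₀, hy⟩ := (hP ▸ mem_univ ((T ^ k₀) b, b) : ((T ^ k₀) b, b) ∈ P)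
    exact ⟨y, by simpa using ⟨h₀, hy⟩⟩

theorem IsSemisimple.areDisjoint_of_dense [Nonempty X] (hT : IsSemisimple T)
    (hd : Dense (disjointPairs T)) (hS : IsMinimalSystem S) : AreDisjoint T S := by
  intro J
  constructor
  swap
  · rintro rfl
    have := hS.1
    exact isJoining_univ T S
  intro hJ
  refine eq_univ_of_forall fun ⟨b, y⟩ => ?_
  let A : Set Y := ⋂ k : ℤ, {y | ((T ^ k) b, y) ∈ J}
  have hcl : ∀ k : ℤ, IsClosed {y | ((T ^ k) b, y) ∈ J} := fun k =>
    hJ.isClosed.preimage (by fun_prop)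
  have hne : A.Nonempty := by
    refine CompactSpace.iInter_nonempty hcl fun F => ?_
    obtain ⟨y, hy⟩ := hJ.exists_forall_zpow_mem hT hd hS F b
    exact ⟨y, by simpa using hy⟩
  have hinv : ∀ y, S y ∈ A ↔ y ∈ A := by
    intro y
    simp only [A, mem_iInter, mem_ofPred_eq]
    -- Shifting `k` absorbs `S`: invariance uses the full orbit, not a finite piece.
    rw [← (Equiv.addRight (1 : ℤ)).forall_congr_right]
    simp [zpow_succ_apply, apply_zpow_comm, hJ.apply_mem_iff]
  have hA : A = univ := hS.eq_univ (isClosed_iInter hcl) hinv hne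
  have hy : y ∈ A := hA ▸ mem_univ y
  simpa using mem_iInter.1 hy 0

end DensePairs

/-! ### Disjointness from minimal systems implies residuality. -/

section Residual

/-- The points whose orbit meets `U`. -/
def saturation {X : Type u} [TopologicalSpace X] (T : X ≃ₜ X) (U : Set X) : Set X :=
  {x | ∃ n : ℤ, (T ^ n) x ∈ U}

/-- The pairs whose orbit under `T × T` meets `U × V`. -/
def pairSaturation {X : Type u} [TopologicalSpace X] (T : X ≃ₜ X) (U V : Set X) : Set (X × X) :=
  {p | ∃ n : ℤ, (T ^ n) p.1 ∈ U ∧ (T ^ n) p.2 ∈ V}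

/-- The pairs `(x, z)` such that, provided the orbits of `x` and `z` meet `U` and `V`, the
`T × T`-orbit of every point of `orbitClosure T x × {z}` meets `U × V`. -/
def hittingPairs {X : Type u} [TopologicalSpace X] (T : X ≃ₜ X) (U V : Set X) : Set (X × X) :=
  {p | p.1 ∈ saturation T U → p.2 ∈ saturation T V →
    ∀ a ∈ orbitClosure T p.1, (a, p.2) ∈ pairSaturation T U V}

section Topological

variable {X : Type u} [TopologicalSpace X] (T : X ≃ₜ X) {U V : Set X}

theorem isOpen_saturation (hU : IsOpen U) : IsOpen (saturation T U) := by
  simp only [saturation, ofPred_exists]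
  exact isOpen_iUnion fun n => hU.preimage (T ^ n).continuous

theorem apply_mem_saturation_iff (x : X) : T x ∈ saturation T U ↔ x ∈ saturation T U :=
  exists_zpow_apply_iff T (· ∈ U) x

theorem isOpen_pairSaturation (hU : IsOpen U) (hV : IsOpen V) :
    IsOpen (pairSaturation T U V) := by
  simp only [pairSaturation, ofPred_exists]
  exact isOpen_iUnion fun n => (hU.preimage ((T ^ n).continuous.comp continuous_fst)).inter
    (hV.preimage ((T ^ n).continuous.comp continuous_snd))

theorem apply_mem_pairSaturation_iff (x z : X) :
    (T x, T z) ∈ pairSaturation T U V ↔ (x, z) ∈ pairSaturation T U V := by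
  simp only [pairSaturation, mem_ofPred_eq]
  constructor
  · rintro ⟨n, hn⟩
    exact ⟨n + 1, by simpa only [zpow_succ_apply] using hn⟩
  · rintro ⟨n, hn⟩
    exact ⟨n - 1, by simpa only [← zpow_succ_apply, sub_add_cancel] using hn⟩

theorem mem_saturation_of_mem_orbitClosure {x p : X} (hU : IsOpen U) (hp : p ∈ orbitClosure T x)
    (hpU : p ∈ U) : x ∈ saturation T U := by
  obtain ⟨_, hq, n, rfl⟩ := mem_closure_iff.1 hp U hU hpU
  exact ⟨n, hq⟩

/-- A pair lying in `hittingPairs T U V` for all basic open `U`, `V` has disjoint orbit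
closures. -/
theorem mem_disjointPairs_of_forall_hittingPairs {B : Set (Set X)}
    (hB : TopologicalSpace.IsTopologicalBasis B) {p : X × X} (hp : ∀ U ∈ B, ∀ V ∈ B, p ∈ hittingPairs T U V) :
    p ∈ disjointPairs T := by
  intro J
  have h₁ : Nonempty (orbitClosure T p.1) := ⟨⟨_, mem_orbitClosure_self T p.1⟩⟩
  have h₂ : Nonempty (orbitClosure T p.2) := ⟨⟨_, mem_orbitClosure_self T p.2⟩⟩
  constructor
  swap
  · rintro rfl
    exact isJoining_univ _ _
  intro hJ
  by_contra hne
  obtain ⟨⟨c, d⟩, hcd⟩ := (ne_univ_iff_exists_notMem J).1 hne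
  obtain ⟨U', V', hU', hV', hcU, hdV, hsub⟩ :=
    isOpen_prod_iff.1 hJ.isClosed.isOpen_compl c d hcd
  obtain ⟨U'', hU'', rfl⟩ := isOpen_induced_iff.1 hU'
  obtain ⟨V'', hV'', rfl⟩ := isOpen_induced_iff.1 hV'
  obtain ⟨U, hUB, hcU, hU⟩ := hB.exists_subset_of_mem_open hcU hU''
  obtain ⟨V, hVB, hdV, hV⟩ := hB.exists_subset_of_mem_open hdV hV''
  obtain ⟨⟨a, ha⟩, haJ⟩ := hJ.exists_left ⟨p.2, mem_orbitClosure_self T p.2⟩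
  obtain ⟨n, hn⟩ := hp U hUB V hVB
    (mem_saturation_of_mem_orbitClosure T (hB.isOpen hUB) c.2 hcU)
    (mem_saturation_of_mem_orbitClosure T (hB.isOpen hVB) d.2 hdV) a ha
  -- `J` seen inside `X × X`, where powers of `T` act: `(a, p.2)` is carried into `U × V`, which
  -- misses `J`.
  let K : Set (X × X) := {q | ∃ h₁ h₂, (⟨q.1, h₁⟩, ⟨q.2, h₂⟩) ∈ J}
  have hK : ∀ x z, (T x, T z) ∈ K ↔ (x, z) ∈ K := by
    intro x z
    constructor
    · rintro ⟨h₁, h₂, h⟩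
      have h₁' := (apply_mem_orbitClosure_iff T _ _).1 h₁
      have h₂' := (apply_mem_orbitClosure_iff T _ _).1 h₂
      exact ⟨h₁', h₂', (hJ.apply_mem_iff ⟨x, h₁'⟩ ⟨z, h₂'⟩).1 h⟩
    · rintro ⟨h₁, h₂, h⟩
      exact ⟨(apply_mem_orbitClosure_iff T _ _).2 h₁, (apply_mem_orbitClosure_iff T _ _).2 h₂,
        (hJ.apply_mem_iff _ _).2 h⟩
  obtain ⟨h₁, h₂, hJ'⟩ := (prod_zpow_mem_iff T hK n a p.2).2 ⟨ha, _, haJ⟩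
  exact hsub (mk_mem_prod (hU hn.1) (hV hn.2)) hJ'

end Topological

variable {X : Type u} [MetricSpace X] [CompactSpace X] {T : X ≃ₜ X} {U V : Set X}

/-- If `X` is disjoint from the orbit closure of `x`, points `z` with `orbitClosure T x × {z}`
inside the saturation of `U × V` exist in every open set contained in the saturation of `V`. -/
theorem DisjointFromAllMinimal.exists_forall_mem_pairSaturation (h : DisjointFromAllMinimal T)
    (hU : IsOpen U) (hV : IsOpen V) {x : X} (hx : IsMinimalPoint T x)
    (hxU : x ∈ saturation T U) {W : Set X} (hW : IsOpen W) (hWne : W.Nonempty)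
    (hWV : W ⊆ saturation T V) :
    ∃ z ∈ W, ∀ a ∈ orbitClosure T x, (a, z) ∈ pairSaturation T U V := by
  by_contra! hbad
  have : CompactSpace (orbitClosure T x) :=
    isCompact_iff_compactSpace.1 isClosed_closure.isCompact
  -- The bad pairs. If every `z ∈ W` were bad, this would be a joining; the fibre over a point whose
  -- orbit misses `W` is everything.
  let J : Set (X × orbitClosure T x) :=
    {p | p.1 ∈ saturation T W → ((p.2 : X), p.1) ∉ pairSaturation T U V}
  have hJcl : IsClosed J := by
    have : J = {p | p.1 ∈ saturation T W ∧ ((p.2 : X), p.1) ∈ pairSaturation T U V}ᶜ := by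
      ext p
      simp [J]
    rw [this, isClosed_compl_iff]
    exact ((isOpen_saturation T hW).preimage continuous_fst).inter
      ((isOpen_pairSaturation T hU hV).preimage (by fun_prop))
  have hJinv : ∀ z y, (T z, orbitSystem T x y) ∈ J ↔ (z, y) ∈ J := by
    intro z y
    simp [J, apply_mem_saturation_iff, apply_mem_pairSaturation_iff]
  have hright : ∀ z, ∃ y, (z, y) ∈ J := by
    intro z
    by_cases hz : z ∈ saturation T W
    · obtain ⟨n, hn⟩ := hz
      obtain ⟨a, ha, haz⟩ := hbad _ hn
      refine ⟨⟨(T ^ (-n)) a, (isInvariant_orbitClosure T x).zpow_mem_iff _ _ |>.2 ha⟩,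
        fun _ h => haz ?_⟩
      have := (prod_zpow_mem_iff T (apply_mem_pairSaturation_iff T) n _ _).2 h
      simpa only [← Homeomorph.mul_apply, ← zpow_add, add_neg_cancel, zpow_zero,
        Homeomorph.one_apply] using this
    · exact ⟨⟨x, mem_orbitClosure_self T x⟩, fun h => absurd h hz⟩
  obtain ⟨w, hw⟩ := hWne
  have hJ : IsJoining T (orbitSystem T x) J :=
    { isClosed := hJcl
      invariant := (isInvariantSet_iff _).2 fun p => hJinv p.1 p.2
      image_fst := eq_univ_of_forall fun z => by
        obtain ⟨y, hy⟩ := hright z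
        exact ⟨(z, y), hy, rfl⟩
      image_snd := by
        refine IsMinimalSystem.eq_univ hx (isClosedMap_snd_of_compactSpace _ hJcl)
          (fun y => ?_) ?_
        · simp only [mem_image, Prod.exists, exists_eq_right]
          rw [T.surjective.exists (p := fun z => (z, orbitSystem T x y) ∈ J)]
          simp only [hJinv]
        · obtain ⟨y, hy⟩ := hright w
          exact ⟨y, (w, y), hy, rfl⟩ }
  have huniv := (h _ _ hx J).1 hJ
  obtain ⟨m, hm⟩ := hWV hw
  obtain ⟨n, hn⟩ := hxU
  -- `(T ^ m) w ∈ V` and `y ∈ U`, so this pair violates the condition defining `J` at time `0`.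
  let y : orbitClosure T x := ⟨(T ^ n) x, subset_closure ⟨n, rfl⟩⟩
  have hmem : ((T ^ m) w, y) ∈ J := huniv ▸ mem_univ _
  exact hmem ⟨-m, by simpa [← Homeomorph.mul_apply] using hw⟩
    ⟨0, by simpa [y] using hn, by simpa using hm⟩

/-- For a semi-simple system disjoint from all minimal systems, `hittingPairs T U V` has dense
interior. -/
theorem DisjointFromAllMinimal.dense_interior_hittingPairs (h : DisjointFromAllMinimal T)
    (hT : IsSemisimple T) (hU : IsOpen U) (hV : IsOpen V) :
    Dense (interior (hittingPairs T U V)) := by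
  refine dense_iff_inter_open.2 fun O hO hOne => ?_
  let A : Set (X × X) := saturation T U ×ˢ saturation T V
  by_cases hOA : (O ∩ A).Nonempty
  swap
  · obtain ⟨p, hp⟩ := hOne
    refine ⟨p, hp, interior_maximal (fun q hq h₁ h₂ => ?_) hO hp⟩
    exact absurd ⟨q, hq, h₁, h₂⟩ hOA
  obtain ⟨⟨c, d⟩, hcd⟩ := hOA
  have hAo : IsOpen A := (isOpen_saturation T hU).prod (isOpen_saturation T hV)
  obtain ⟨W₁, W₂, hW₁, hW₂, hcW, hdW, hsub⟩ := isOpen_prod_iff.1 (hO.inter hAo) c d hcd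
  have hB := TopologicalSpace.isBasis_countableBasis X
  -- Closed sets of pairs at distance at least `1 / (m + 1)` from the complement; closedness makes
  -- each `G i` closed and later lets orbits be replaced by their closures.
  let far : ℕ → Set (X × X) := fun m =>
    (Metric.thickening (1 / ((m : ℝ) + 1)) (pairSaturation T U V)ᶜ)ᶜ
  have hfar : ∀ m, IsClosed (far m) := fun m => Metric.isOpen_thickening.isClosed_compl
  have hfar_sub : ∀ m, far m ⊆ pairSaturation T U V := fun m p hp => by
    by_contra hp'
    exact hp (Metric.self_subset_thickening (by positivity) _ hp')
  let 𝓑 : Set (Set X) := {B | B ∈ TopologicalSpace.countableBasis X ∧ B ⊆ W₂}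
  have : Countable 𝓑 :=
    ((TopologicalSpace.countable_countableBasis X).mono fun B hB => hB.1).to_subtype
  let G : ℕ × 𝓑 → Set W₁ := fun i =>
    {x | ∀ n : ℤ, ∀ b ∈ (i.2 : Set X), ((T ^ n) (x : X), b) ∈ far i.1}
  have hGcl : ∀ i, IsClosed (G i) := by
    intro i
    simp only [G, ofPred_forall]
    exact isClosed_iInter fun n => isClosed_iInter fun b => isClosed_iInter fun _ =>
      (hfar i.1).preimage (((T ^ n).continuous.comp continuous_subtype_val).prodMk
        continuous_const)
  have hGcover : ⋃ i, G i = univ := by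
    refine eq_univ_of_forall fun x => ?_
    obtain ⟨z, hz, hxz⟩ := h.exists_forall_mem_pairSaturation hU hV (hT x)
      (hsub (mk_mem_prod x.2 hdW)).2.1 hW₂ ⟨d, hdW⟩ fun w hw => (hsub (mk_mem_prod hcW hw)).2.2
    -- Compactness gives a margin `δ`: half of it is spent on moving `z` within `B`, half on staying
    -- `far`.
    have hK : IsCompact (orbitClosure T (x : X) ×ˢ ({z} : Set X)) :=
      isClosed_closure.isCompact.prod isCompact_singleton
    obtain ⟨δ, hδ, hthick⟩ := hK.exists_thickening_subset_open
      (isOpen_pairSaturation T hU hV) (by rintro ⟨a, b⟩ ⟨ha, rfl⟩; exact hxz a ha)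
    obtain ⟨m, hm⟩ := exists_nat_one_div_lt (half_pos hδ)
    obtain ⟨B, hBB, hzB, hBsub⟩ := hB.exists_subset_of_mem_open
      (show z ∈ W₂ ∩ Metric.ball z (δ / 2) from ⟨hz, Metric.mem_ball_self (half_pos hδ)⟩)
      (hW₂.inter Metric.isOpen_ball)
    refine mem_iUnion.2 ⟨(m, ⟨B, hBB, fun b hb => (hBsub hb).1⟩), fun n b hb hthin => ?_⟩
    obtain ⟨q, hq, hdist⟩ := Metric.mem_thickening_iff.1 hthin
    refine hq (hthick (Metric.mem_thickening_iff.2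
      ⟨((T ^ n) (x : X), z), ⟨subset_closure ⟨n, rfl⟩, rfl⟩, ?_⟩))
    have hbz : dist ((T ^ n) (x : X), b) ((T ^ n) (x : X), z) < δ / 2 := by
      simpa [Prod.dist_eq, half_pos hδ] using (hBsub hb).2
    have := dist_triangle_left q ((T ^ n) (x : X), z) ((T ^ n) (x : X), b)
    linarith
  have : BaireSpace W₁ := hW₁.baireSpace
  have : Nonempty W₁ := ⟨⟨c, hcW⟩⟩
  -- Baire: one margin and one `B` serve all `x` in an open subset of `W₁`.
  obtain ⟨⟨m, B, hBB, hBW⟩, x, hx⟩ := nonempty_interior_of_iUnion_of_closed hGcl hGcover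
  obtain ⟨b, hb⟩ := TopologicalSpace.nonempty_of_mem_countableBasis hBB
  refine ⟨(x, b), (hsub (mk_mem_prod x.2 (hBW hb))).1, ?_⟩
  refine interior_maximal (t := ((↑) '' interior (G (m, ⟨B, hBB, hBW⟩))) ×ˢ B) ?_
    ((hW₁.isOpenMap_subtype_val _ isOpen_interior).prod (hB.isOpen hBB)) ⟨⟨x, hx, rfl⟩, hb⟩
  rintro ⟨_, b⟩ ⟨⟨x, hx, rfl⟩, hb⟩ - - a ha
  have hcl : IsClosed {a | (a, b) ∈ far m} := (hfar m).preimage (by fun_prop)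
  refine hfar_sub m (closure_minimal ?_ hcl ha)
  rintro _ ⟨n, rfl⟩
  exact interior_subset hx n b hb

end Residual

end TopDyn

theorem theoremC {X : Type*} [MetricSpace X] [CompactSpace X] [Nonempty X] (T : X ≃ₜ X)
    (hT : TopDyn.IsSemisimple T) :
    TopDyn.DisjointFromAllMinimal T ↔ TopDyn.disjointPairs T ∈ residual (X × X) := by
  constructor
  · intro h
    have hB := TopologicalSpace.isBasis_countableBasis X
    have hc := TopologicalSpace.countable_countableBasis X
    have key : (⋂ U ∈ TopologicalSpace.countableBasis X,
        ⋂ V ∈ TopologicalSpace.countableBasis X, TopDyn.hittingPairs T U V) ∈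
          residual (X × X) := by
      refine (countable_bInter_mem hc).2 fun U hU => (countable_bInter_mem hc).2 fun V hV => ?_
      exact Filter.mem_of_superset (residual_of_dense_open isOpen_interior
        (h.dense_interior_hittingPairs hT (hB.isOpen hU) (hB.isOpen hV))) interior_subset
    refine Filter.mem_of_superset key fun p hp => ?_
    simp only [Set.mem_iInter] at hp
    exact TopDyn.mem_disjointPairs_of_forall_hittingPairs T hB hp
  · intro h Y _ _ S hS
    exact hT.areDisjoint_of_dense (dense_of_mem_residual h) hS
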